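/- Let $\kappa$ be a singular cardinal of countable cofinality, and let $X$ be a regular topological space such that $$\Delta(X)\ \ge\ \kappa\ \ge\ \widehat{e}(X).$$ Then $X$ is $2$-resolvable, that is, $X$ contains two disjoint dense subsets. Here $\Delta(X)=\min\{|G| : G \text{ is a non-empty open subset of } X\}$ is the dispersion character of $X$, and $\widehat{e}(X)$ is the smallest cardinal $\lambda$ such that $X$ has no closed-and-discrete subset of size $\lambda$. -/

import Mathlib

open Cardinal

universe u

/-- `X` is `μ`-resolvable: it contains `μ` many mutually disjoint dense subsets. -/
def IsResolvable (X : Type u) [TopologicalSpace X] (μ : Cardinal.{u}) : Prop :=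
  ∃ D : Set (Set X), #D = μ ∧ D.PairwiseDisjoint id ∧ ∀ A ∈ D, Dense A

/-- The dispersion character `Δ(X)`: the least cardinality of a non-empty open subset of `X`
(for empty `X` there is no such set and the value is `0`). -/
noncomputable def dispersionCharacter (X : Type u) [TopologicalSpace X] : Cardinal.{u} :=
  sInf {μ | ∃ G : Set X, IsOpen G ∧ G.Nonempty ∧ #G = μ}

/-- The cardinal `ê(X)`: the least cardinal `μ` such that `X` has no closed-and-discrete subset
of size `μ`. -/
noncomputable def hatExtent (X : Type u) [TopologicalSpace X] : Cardinal.{u} :=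
  sInf {μ | ¬ ∃ A : Set X, IsClosed A ∧ IsDiscrete A ∧ #A = μ}

/-- The infimum in the definition of `ê(X)` is over a non-empty class, hence attained. -/
theorem hatExtent_spec (X : Type u) [TopologicalSpace X] :
    ¬ ∃ A : Set X, IsClosed A ∧ IsDiscrete A ∧ #A = hatExtent X := by
  have h : {μ : Cardinal.{u} |
      ¬ ∃ A : Set X, IsClosed A ∧ IsDiscrete A ∧ #A = μ}.Nonempty := by
    refine ⟨Order.succ #X, ?_⟩
    rintro ⟨A, -, -, hA⟩
    exact (Order.lt_succ #X).not_ge (hA ▸ mk_set_le A)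
  exact csInf_mem h

open Set Filter Topology

/-! ### Cardinal arithmetic and ranks. -/

section Cardinality

/-! If `X` is not 2-resolvable, some non-empty open `O` is hereditarily irresolvable. The key fact
(`exists_forall_not_accPt`) is that if `μ` is infinite and all non-empty open subsets of `O` have
more than `μ` points, then `O` contains `μ` points with no accumulation point in `X`. Otherwise some
open `G ⊆ O` would carry a rank for which the limits of points of smaller rank and the remaining
points are both dense in `G`.

With `μ = κ`, the bound on `ê(X)` forces an open `V₀ ⊆ O` of size exactly `κ`. Countable cofinality
gives `V₀ = ⋃ Y n` with each `Y n` smaller than `κ`, hence nowhere dense in `O`. So there are nested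
open sets `V n`, with `closure (V (n + 1)) ⊆ V n` and `V (n + 1)` missing `Y n`, whose closures have
empty intersection. Sets `D n ⊆ V n` without accumulation points and with `#(Y n) ≤ #(D n)` then
have a union that is closed, discrete and of size at least `κ`, a contradiction. -/

theorem mk_biUnion_le_of_forall_le {α ι : Type u} {μ : Cardinal.{u}} (hμ : ℵ₀ ≤ μ) {s : Set ι}
    {A : ι → Set α} (hs : #s ≤ μ) (hA : ∀ x ∈ s, #(A x) ≤ μ) : #(⋃ x ∈ s, A x : Set α) ≤ μ :=
  (mk_biUnion_le A s).trans <|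
    (mul_le_mul' hs (ciSup_le' fun x : s => hA x x.2)).trans (mul_eq_self hμ).le

theorem mk_iUnion_nat_le {α : Type u} {μ : Cardinal.{u}} (hμ : ℵ₀ ≤ μ) {A : ℕ → Set α}
    (hA : ∀ n, #(A n) ≤ μ) : #(⋃ n, A n) ≤ μ := by
  have h := mk_iUnion_le_lift A
  rw [lift_uzero, mk_nat, lift_aleph0] at h
  refine h.trans ((mul_le_mul' hμ (ciSup_le' fun n => ?_)).trans (mul_eq_self hμ).le)
  rw [lift_uzero]
  exact hA n

theorem mk_union_le_of_le {α : Type u} {μ : Cardinal.{u}} (hμ : ℵ₀ ≤ μ) {A B : Set α}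
    (hA : #A ≤ μ) (hB : #B ≤ μ) : #(A ∪ B : Set α) ≤ μ :=
  (mk_union_le A B).trans ((add_le_add hA hB).trans (add_eq_self hμ).le)

/-- A set whose cardinality has countable cofinality is a countable union of smaller sets. -/
theorem exists_iUnion_eq_of_cof_eq_aleph0 {α : Type u} {κ : Cardinal.{u}} (hκ : ℵ₀ ≤ κ)
    (hcof : κ.ord.cof = ℵ₀) {V : Set α} (hV : #V = κ) :
    ∃ Y : ℕ → Set α, (∀ n, #(Y n) < κ) ∧ ⋃ n, Y n = V := by
  obtain ⟨s, hs, hsc⟩ := Order.exists_cof_eq κ.ord.ToType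
  rw [Ordinal.cof_toType, hcof] at hsc
  have hcount : s.Countable := by rw [← le_aleph0_iff_set_countable, hsc]
  have hne : s.Nonempty := by
    rw [nonempty_iff_ne_empty]
    rintro rfl
    exact aleph0_ne_zero (hsc.symm.trans (mk_eq_zero _))
  obtain ⟨f, rfl⟩ := hcount.exists_eq_range hne
  obtain ⟨e⟩ : Nonempty (V ≃ κ.ord.ToType) := by
    rw [← Cardinal.eq, hV, mk_ord_toType]
  refine ⟨fun n => (fun i => (e.symm i : α)) '' Iic (f n), fun n => ?_, ?_⟩
  · refine mk_image_le.trans_lt ?_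
    rw [← Iio_insert]
    refine (mk_insert_le).trans_lt (add_lt_of_lt hκ ?_ ?_)
    · exact (mk_Iio_lt (f n) (by simp)).trans_eq (mk_ord_toType κ)
    · exact one_lt_aleph0.trans_le hκ
  · apply subset_antisymm
    · refine iUnion_subset fun n => ?_
      rintro _ ⟨i, -, rfl⟩
      exact (e.symm i).2
    · intro x hx
      obtain ⟨_, ⟨n, rfl⟩, hn⟩ := hs (e ⟨x, hx⟩)
      exact mem_iUnion.2 ⟨n, e ⟨x, hx⟩, hn, by simp⟩

theorem exists_subset_injOn_mk_eq {α β : Type u} {μ : Cardinal.{u}} (hμ : ℵ₀ ≤ μ) {V : Set α}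
    (hV : μ < #V) (r : α → β) (hr : ∀ b, #(r ⁻¹' {b}) ≤ μ) :
    ∃ E ⊆ V, InjOn r E ∧ #E = μ := by
  obtain ⟨F, hFV, hF⟩ := (surjOn_image r V).exists_bijOn_subset
  have hle : μ ≤ #F := by
    by_contra! hlt
    refine hV.not_ge ?_
    have hsub : V ⊆ ⋃ b ∈ r '' V, r ⁻¹' {b} := fun x hx =>
      mem_biUnion (mem_image_of_mem r hx) rfl
    refine (mk_le_mk_of_subset hsub).trans (mk_biUnion_le_of_forall_le hμ ?_ fun b _ => hr b)
    rw [← hF.image_eq]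
    exact mk_image_le.trans hlt.le
  obtain ⟨E, hEF, hE⟩ := le_mk_iff_exists_subset.1 hle
  exact ⟨E, hEF.trans hFV, hF.injOn.mono hEF, hE⟩

/-- If every point is assigned a set of size at most `μ`, the points can be ranked by a well-order
so that all fibres have size at most `μ` and no member of `A x` has rank above that of `x`. -/
theorem exists_rank {α : Type u} {μ : Cardinal.{u}} (hμ : ℵ₀ ≤ μ) (A : α → Set α)
    (hA : ∀ x, #(A x) ≤ μ) :
    ∃ (_ : LinearOrder α) (_ : WellFoundedLT α) (r : α → α),
      (∀ b, #(r ⁻¹' {b}) ≤ μ) ∧ ∀ x, ∀ y ∈ A x, r y ≤ r x := by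
  classical
  obtain ⟨lo, wf⟩ := exists_wellFoundedLT α
  -- `C y n` collects the endpoints of `A`-chains of length `n` from `y`. The rank of `x` is the
  -- least `y` from which `x` can be reached; whatever reaches `x` also reaches every member of `A
  -- x`.
  let C : α → ℕ → Set α := fun y n => Nat.rec {y} (fun _ S => ⋃ x ∈ S, A x) n
  have hC : ∀ y n, #↥(C y n) ≤ μ := by
    intro y n
    induction n with
    | zero => exact (mk_singleton y).trans_le (one_le_aleph0.trans hμ)
    | succ n ih => exact mk_biUnion_le_of_forall_le hμ ih fun x _ => hA x
  have hne : ∀ x, {y | ∃ n, x ∈ C y n}.Nonempty := fun x => ⟨x, 0, rfl⟩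
  let r : α → α := fun x => wellFounded_lt.min {y | ∃ n, x ∈ C y n} (hne x)
  have hr : ∀ x, ∃ n, x ∈ C (r x) n := fun x =>
    WellFounded.min_mem wellFounded_lt {y | ∃ n, x ∈ C y n} (hne x)
  refine ⟨lo, wf, r, fun b => ?_, fun x y hy => ?_⟩
  · refine (mk_le_mk_of_subset ?_).trans (mk_iUnion_nat_le hμ (hC b))
    rintro x rfl
    exact mem_iUnion.2 (hr x)
  · obtain ⟨n, hn⟩ := hr x
    refine not_lt.1 (WellFounded.not_lt_min wellFounded_lt _ ?_)
    exact ⟨n + 1, mem_biUnion hn hy⟩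

end Cardinality

/-! ### Hereditary irresolvability and sets without accumulation points. -/

section Resolvability

variable {X : Type u} [TopologicalSpace X]

/-- Two disjoint sets with the same closure; equivalently, both are dense in their union. -/
structure MutuallyDense (A B : Set X) : Prop where
  disjoint : Disjoint A B
  left : A ⊆ closure B
  right : B ⊆ closure A

/-- No non-empty subspace of `O` splits into two disjoint dense subsets. -/
def HereditarilyIrresolvableOn (O : Set X) : Prop :=
  ∀ A B : Set X, A ⊆ O → B ⊆ O → MutuallyDense A B → A = ∅

theorem isResolvable_two_of_dense [Nonempty X] {A B : Set X} (h : Disjoint A B) (hA : Dense A)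
    (hB : Dense B) : IsResolvable X 2 := by
  have hne : A ≠ B := by
    rintro rfl
    exact hA.nonempty.ne_empty (disjoint_self.1 h)
  refine ⟨{A, B}, ?_, ?_, ?_⟩
  · rw [mk_insert (by simpa using hne), mk_singleton, one_add_one_eq_two]
  · rw [PairwiseDisjoint, pairwise_pair_of_symm]
    exact fun _ => h
  · rintro C (rfl | rfl) <;> assumption

/-- Off the closure of a maximal mutually dense pair no further pair can exist, since it could be
adjoined. That closure is not all of `X`, as otherwise the pair would resolve `X`. -/
theorem exists_isOpen_hereditarilyIrresolvableOn [Nonempty X] (h : ¬ IsResolvable X 2) :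
    ∃ O : Set X, IsOpen O ∧ O.Nonempty ∧ HereditarilyIrresolvableOn O := by
  obtain ⟨⟨A, B⟩, hmax⟩ : ∃ m : Set X × Set X, Maximal (fun p => MutuallyDense p.1 p.2) m := by
    refine zorn_le₀ _ fun c hc hchain => ?_
    refine ⟨(⋃ p ∈ c, p.1, ⋃ p ∈ c, p.2), ⟨?_, ?_, ?_⟩, fun p hp =>
      ⟨subset_biUnion_of_mem (u := fun p : Set X × Set X => p.1) hp,
        subset_biUnion_of_mem (u := fun p : Set X × Set X => p.2) hp⟩⟩
    · simp only [disjoint_iUnion_left, disjoint_iUnion_right]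
      intro q hq p hp
      rcases hchain.total hp hq with hpq | hpq
      · exact (hc hq).disjoint.mono_left hpq.1
      · exact (hc hp).disjoint.mono_right hpq.2
    · refine iUnion₂_subset fun p hp => (hc hp).left.trans (closure_mono ?_)
      exact subset_biUnion_of_mem (u := fun p : Set X × Set X => p.2) hp
    · refine iUnion₂_subset fun p hp => (hc hp).right.trans (closure_mono ?_)
      exact subset_biUnion_of_mem (u := fun p : Set X × Set X => p.1) hp
  have hAB : MutuallyDense A B := hmax.prop
  refine ⟨(closure A)ᶜ, isClosed_closure.isOpen_compl, ?_, fun A' B' hA' hB' h' => ?_⟩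
  · rw [nonempty_compl]
    intro hA
    refine h (isResolvable_two_of_dense hAB.disjoint (dense_iff_closure_eq.2 hA) ?_)
    rw [dense_iff_closure_eq, ← univ_subset_iff, ← hA]
    exact closure_minimal hAB.left isClosed_closure
  · have hnew : MutuallyDense (A ∪ A') (B ∪ B') := by
      refine ⟨?_, ?_, ?_⟩
      · simp only [disjoint_union_left, disjoint_union_right]
        refine ⟨⟨hAB.disjoint, ?_⟩, ?_, h'.disjoint⟩
        · exact disjoint_left.2 fun x hx hx' => hA' hx (hAB.right hx')
        · exact disjoint_left.2 fun x hx hx' => hB' hx' (subset_closure hx)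
      · rw [closure_union]
        exact union_subset_union hAB.left h'.left
      · rw [closure_union]
        exact union_subset_union hAB.right h'.right
    have hle : A ∪ A' ⊆ A := (hmax.le_of_ge (y := (A ∪ A', B ∪ B')) hnew ⟨subset_union_left, subset_union_left⟩).1
    rw [eq_empty_iff_forall_notMem]
    exact fun x hx => hA' hx (subset_closure (hle (Or.inr hx)))

namespace HereditarilyIrresolvableOn

variable {O : Set X}

theorem mono {W : Set X} (hO : HereditarilyIrresolvableOn O) (hW : W ⊆ O) :
    HereditarilyIrresolvableOn W := fun A B hA hB => hO A B (hA.trans hW) (hB.trans hW)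

/-- Every contradiction with irresolvability below an open set takes this form: a set and its
complement cannot both be dense in `W`. -/
theorem not_subset_closure_diff (hO : HereditarilyIrresolvableOn O) {W S : Set X} (hW : IsOpen W)
    (hne : W.Nonempty) (hWO : W ⊆ O) (hS : W ⊆ closure S) : ¬ W ⊆ closure (W \ S) := by
  intro hS'
  have h : W ⊆ closure (W ∩ S) := fun x hx => hW.inter_closure ⟨hx, hS hx⟩
  have hemp : W ∩ S = ∅ := hO (W ∩ S) (W \ S) (inter_subset_left.trans hWO) (sdiff_subset.trans hWO)
    ⟨disjoint_sdiff_right.mono_left inter_subset_right, inter_subset_left.trans hS',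
      sdiff_subset.trans h⟩
  rw [hemp, closure_empty] at h
  exact hne.ne_empty (subset_empty_iff.1 h)

/-- Stands in for T₁, which is not assumed: specialization is symmetric in a regular space, so
distinct `x`, `y` would give a mutually dense pair of singletons. -/
theorem eq_of_mem_closure_singleton [RegularSpace X] (hO : HereditarilyIrresolvableOn O) {x y : X}
    (hx : x ∈ O) (hy : y ∈ O) (h : x ∈ closure {y}) : x = y := by
  by_contra hne
  have hs : x ⤳ y := specializes_iff_mem_closure.2 h |>.symm
  refine singleton_ne_empty x (hO {x} {y} (singleton_subset_iff.2 hx) (singleton_subset_iff.2 hy)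
    ⟨disjoint_singleton.2 hne, singleton_subset_iff.2 h, singleton_subset_iff.2 ?_⟩)
  exact specializes_iff_mem_closure.1 hs

end HereditarilyIrresolvableOn

/-- A point `x` lies in the closure of a set of size at most `μ` that avoids any prescribed set of
size at most `μ`. -/
def IsAvoidingLimit (μ : Cardinal.{u}) (x : X) : Prop :=
  ∀ A : Set X, #A ≤ μ → ∃ B : Set X, #B ≤ μ ∧ Disjoint A B ∧ x ∈ closure B

/-- Otherwise, iterating from one point yields disjoint sets, each contained in the closure of every
later one. The unions of the even and of the odd stages are then mutually dense. -/
theorem HereditarilyIrresolvableOn.exists_not_isAvoidingLimit {O : Set X}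
    (hO : HereditarilyIrresolvableOn O) {μ : Cardinal.{u}} (hμ : ℵ₀ ≤ μ) (hopen : IsOpen O)
    (hne : O.Nonempty) : ∃ x ∈ O, ¬ IsAvoidingLimit μ x := by
  by_contra! hall
  have hstep : ∀ C : Set X, ∃ B : Set X, C ⊆ O → #C ≤ μ →
      B ⊆ O ∧ #B ≤ μ ∧ Disjoint C B ∧ C ⊆ closure B := by
    intro C
    by_cases hC : C ⊆ O ∧ #C ≤ μ
    swap
    · exact ⟨∅, fun h h' => (hC ⟨h, h'⟩).elim⟩
    have hx : ∀ x : X, ∃ B : Set X, x ∈ C → #B ≤ μ ∧ Disjoint C B ∧ x ∈ closure B := by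
      intro x
      by_cases hxC : x ∈ C
      · obtain ⟨B, hB⟩ := hall x (hC.1 hxC) C hC.2
        exact ⟨B, fun _ => hB⟩
      · exact ⟨∅, fun h => (hxC h).elim⟩
    choose B hB using hx
    refine ⟨O ∩ ⋃ x ∈ C, B x, fun _ _ => ⟨inter_subset_left, ?_, ?_, fun x hxC => ?_⟩⟩
    · exact (mk_le_mk_of_subset inter_subset_right).trans
        (mk_biUnion_le_of_forall_le hμ hC.2 fun x hx => (hB x hx).1)
    · refine Disjoint.mono_right inter_subset_right ?_
      simp only [disjoint_iUnion_right]
      exact fun x hx => (hB x hx).2.1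
    · exact hopen.inter_closure
        ⟨hC.1 hxC, closure_mono (subset_biUnion_of_mem hxC) (hB x hxC).2.2⟩
  choose F hF using hstep
  obtain ⟨x₀, hx₀⟩ := hne
  let C : ℕ → Set X := fun n => Nat.rec {x₀} (fun _ S => S ∪ F S) n
  have hCsucc : ∀ n, C (n + 1) = C n ∪ F (C n) := fun n => rfl
  have hC : ∀ n, C n ⊆ O ∧ #↥(C n) ≤ μ := by
    intro n
    induction n with
    | zero =>
      exact ⟨singleton_subset_iff.2 hx₀, (mk_singleton x₀).trans_le (one_le_aleph0.trans hμ)⟩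
    | succ n ih =>
      rw [hCsucc]
      have := hF _ ih.1 ih.2
      exact ⟨union_subset ih.1 this.1, mk_union_le_of_le hμ ih.2 this.2.1⟩
  have hmono : Monotone C := monotone_nat_of_le_succ fun n => (hCsucc n).symm ▸ subset_union_left
  have hFC : ∀ n, F (C n) ⊆ C (n + 1) := fun n => (hCsucc n).symm ▸ subset_union_right
  have hdisj : ∀ m n, m < n → Disjoint (F (C m)) (F (C n)) := fun m n hmn =>
    (hF _ (hC n).1 (hC n).2).2.2.1.mono_left ((hFC m).trans (hmono hmn))
  have hcl : ∀ m n, m < n → F (C m) ⊆ closure (F (C n)) := fun m n hmn =>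
    ((hFC m).trans (hmono hmn)).trans (hF _ (hC n).1 (hC n).2).2.2.2
  have hemp := hO (⋃ n, F (C (2 * n))) (⋃ n, F (C (2 * n + 1)))
    (iUnion_subset fun n => (hF _ (hC (2 * n)).1 (hC (2 * n)).2).1)
    (iUnion_subset fun n => (hF _ (hC (2 * n + 1)).1 (hC (2 * n + 1)).2).1) ⟨?_, ?_, ?_⟩
  · have h0 : x₀ ∈ closure (F (C 0)) := (hF _ (hC 0).1 (hC 0).2).2.2.2 (mem_singleton x₀)
    rw [iUnion_eq_empty.1 hemp 0, closure_empty] at h0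
    exact h0
  · simp only [disjoint_iUnion_left, disjoint_iUnion_right]
    intro m n
    rcases lt_or_gt_of_ne (show 2 * n ≠ 2 * m + 1 by omega) with h | h
    · exact hdisj _ _ h
    · exact (hdisj _ _ h).symm
  · refine iUnion_subset fun n => (hcl _ (2 * n + 1) (by omega)).trans (closure_mono ?_)
    exact subset_iUnion (fun n => F (C (2 * n + 1))) n
  · refine iUnion_subset fun n => (hcl (2 * n + 1) (2 * (n + 1)) (by omega)).trans (closure_mono ?_)
    exact subset_iUnion (fun n => F (C (2 * n))) (n + 1)

theorem exists_isOpen_closure_subset [RegularSpace X] {V : Set X} (hV : IsOpen V)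
    (hne : V.Nonempty) : ∃ W : Set X, IsOpen W ∧ W.Nonempty ∧ closure W ⊆ V := by
  obtain ⟨x, hx⟩ := hne
  obtain ⟨F, ⟨hFx, hFc⟩, hFV⟩ := (closed_nhds_basis x).mem_iff.1 (hV.mem_nhds hx)
  refine ⟨interior F, isOpen_interior, ⟨x, mem_interior_iff_mem_nhds.2 hFx⟩, ?_⟩
  exact (closure_minimal interior_subset hFc).trans hFV

/-- An open set which is hereditarily irresolvable and all of whose non-empty open subsets have
more than `μ` points contains a set of size `μ` without accumulation points. -/
theorem HereditarilyIrresolvableOn.exists_forall_not_accPt [RegularSpace X] {O : Set X}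
    (hO : HereditarilyIrresolvableOn O) {μ : Cardinal.{u}} (hμ : ℵ₀ ≤ μ) (hopen : IsOpen O)
    (hne : O.Nonempty) (hcard : ∀ V ⊆ O, IsOpen V → V.Nonempty → μ < #V) :
    ∃ E ⊆ O, #E = μ ∧ ∀ x, ¬ AccPt x (𝓟 E) := by
  by_contra! hacc
  let N : Set X := {x | x ∈ O ∧ ¬ IsAvoidingLimit μ x}
  have hNdense : O ⊆ closure N := by
    intro x hx
    rw [mem_closure_iff]
    intro U hU hxU
    obtain ⟨y, hy, hyN⟩ := (hO.mono inter_subset_right).exists_not_isAvoidingLimit hμ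
      (hU.inter hopen) ⟨x, hxU, hx⟩
    exact ⟨y, hy.1, hy.2, hyN⟩
  obtain ⟨G, hG, hGne, hGN⟩ : ∃ G : Set X, IsOpen G ∧ G.Nonempty ∧ G ⊆ N := by
    obtain ⟨x, hx, hxc⟩ := not_subset.1 (hO.not_subset_closure_diff hopen hne subset_rfl hNdense)
    rw [mem_closure_iff] at hxc
    push Not at hxc
    obtain ⟨U, hU, hxU, hUe⟩ := hxc
    refine ⟨U ∩ O, hU.inter hopen, ⟨x, hxU, hx⟩, fun y hy => by_contra fun hyN => ?_⟩
    exact notMem_empty y (hUe ▸ ⟨hy.1, hy.2, hyN⟩)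
  have hGO : G ⊆ O := fun x hx => (hGN hx).1
  have hA : ∀ x, ∃ A : Set X, #A ≤ μ ∧
      (x ∈ G → ∀ B : Set X, #B ≤ μ → Disjoint A B → x ∉ closure B) := by
    intro x
    by_cases hx : x ∈ G
    · have := (hGN hx).2
      unfold IsAvoidingLimit at this
      push Not at this
      obtain ⟨A, hA, h⟩ := this
      exact ⟨A, hA, fun _ => h⟩
    · exact ⟨∅, by simp, fun h => (hx h).elim⟩
  choose A hAcard hA using hA
  obtain ⟨lo, wf, r, hfib, hr⟩ := exists_rank hμ A hAcard
  -- The limits of points of `G` of smaller rank.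
  let L : Set X := {p | p ∈ closure {b ∈ G | r b < r p}}
  have hL : G ⊆ closure L := by
    intro x hx
    rw [mem_closure_iff]
    intro U hU hxU
    -- An accumulation point of a subset of `V` may leave `V`, but not `U ∩ G`.
    obtain ⟨V, hV, hVne, hVU⟩ := exists_isOpen_closure_subset (hU.inter hG) ⟨x, hxU, hx⟩
    have hVG : V ⊆ G := (subset_closure.trans hVU).trans inter_subset_right
    obtain ⟨E, hEV, hinj, hE⟩ := exists_subset_injOn_mk_eq hμ
      (hcard V (hVG.trans hGO) hV hVne) r hfib
    obtain ⟨p, hp⟩ := hacc E (hEV.trans (hVG.trans hGO)) hE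
    rw [accPt_principal_iff_clusterPt, ← mem_closure_iff_clusterPt] at hp
    have hpUG : p ∈ U ∩ G := hVU (closure_mono (sdiff_subset.trans hEV) hp)
    refine ⟨p, hpUG.1, ?_⟩
    -- Points ranked above `p` miss `A p`, so they do not accumulate at `p`; at most one point of
    -- `E` shares the rank of `p`. Only smaller ranks remain.
    have hsplit : E \ {p} ⊆ {b ∈ G | r b < r p} ∪ ({b ∈ E | r b = r p ∧ b ≠ p} ∪
        {b ∈ E | r p < r b}) := by
      rintro b ⟨hbE, hbp⟩
      rcases lt_trichotomy (r b) (r p) with h | h | h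
      · exact Or.inl ⟨hVG (hEV hbE), h⟩
      · exact Or.inr (Or.inl ⟨hbE, h, hbp⟩)
      · exact Or.inr (Or.inr ⟨hbE, h⟩)
    have hp' := closure_mono hsplit hp
    rw [closure_union, closure_union] at hp'
    rcases hp' with hp' | hp' | hp'
    · exact hp'
    · exfalso
      have hsub : {b ∈ E | r b = r p ∧ b ≠ p}.Subsingleton := fun b hb c hc =>
        hinj hb.1 hc.1 (hb.2.1.trans hc.2.1.symm)
      rcases hsub.eq_empty_or_singleton with h | ⟨b, h⟩
      · rw [h, closure_empty] at hp'
        exact hp'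
      · have hb : b ∈ {b ∈ E | r b = r p ∧ b ≠ p} := h ▸ mem_singleton b
        rw [h] at hp'
        exact hb.2.2 (hO.eq_of_mem_closure_singleton (hGO hpUG.2) (hGO (hVG (hEV hb.1))) hp').symm
    · exfalso
      refine hA p hpUG.2 _ ((mk_le_mk_of_subset (sep_subset E _)).trans hE.le) ?_ hp'
      exact disjoint_left.2 fun b hbA hb => hb.2.not_ge (hr p b hbA)
  refine hO.not_subset_closure_diff hG hGne hGO hL fun x hx => ?_
  rw [mem_closure_iff]
  intro U hU hxU
  -- A point of least rank in `U ∩ G` cannot lie in `L`, so `G \ L` is dense in `G` as well.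
  obtain ⟨p, hp, hmin⟩ := exists_minimalFor_of_wellFoundedLT (· ∈ U ∩ G) r ⟨x, hxU, hx⟩
  refine ⟨p, hp.1, hp.2, fun hpL => ?_⟩
  obtain ⟨b, hbU, hbG, hb⟩ := mem_closure_iff.1 hpL U hU hp.1
  exact hb.not_ge (hmin ⟨hbU, hbG⟩ hb.le)

/-- A union of sets without accumulation points that shrink away from every point has no
accumulation points. -/
theorem not_accPt_iUnion_of_eventually {D V : ℕ → Set X} (hD : ∀ n x, ¬ AccPt x (𝓟 (D n)))
    (hDV : ∀ n, D n ⊆ V n) (hV : Antitone V) (hemp : ⋂ n, closure (V n) = ∅) (x : X) :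
    ¬ AccPt x (𝓟 (⋃ n, D n)) := by
  obtain ⟨n, hn⟩ : ∃ n, x ∉ closure (V n) := by
    by_contra! h
    exact notMem_empty x (hemp ▸ mem_iInter.2 h)
  have hfin : ∀ m, ¬ AccPt x (𝓟 (⋃ k < m, D k)) := by
    intro m
    induction m with
    | zero => simp [AccPt]
    | succ m ih =>
      rw [biUnion_lt_succ, ← sup_principal, accPt_sup]
      exact not_or.2 ⟨ih, hD m x⟩
  intro hx
  refine hfin n ?_
  rw [accPt_iff_nhds] at hx ⊢
  intro U hU
  obtain ⟨y, ⟨⟨hyU, hyV⟩, hy⟩, hne⟩ :=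
    hx (U ∩ (closure (V n))ᶜ) (inter_mem hU (isClosed_closure.isOpen_compl.mem_nhds hn))
  obtain ⟨k, hk⟩ := mem_iUnion.1 hy
  refine ⟨y, ⟨hyU, mem_iUnion₂.2 ⟨k, lt_of_not_ge fun hnk => hyV ?_, hk⟩⟩, hne⟩
  exact subset_closure (hV hnk (hDV k hk))

/-- Having no accumulation points passes to subsets, so a larger `D` would contain a closed discrete
set of size exactly `hatExtent X`. -/
theorem mk_lt_hatExtent_of_forall_not_accPt {D : Set X} (hD : ∀ x, ¬ AccPt x (𝓟 D)) :
    #D < hatExtent X := by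
  by_contra! hle
  obtain ⟨E, hED, hE⟩ := le_mk_iff_exists_subset.1 hle
  have h : IsClosed E ∧ IsDiscrete E := isClosed_and_discrete_iff.2 fun x => by
    rw [disjoint_iff, ← not_neBot]
    exact fun h => hD x (AccPt.mono h (principal_mono.2 hED))
  exact hatExtent_spec X ⟨E, h.1, h.2, hE⟩

theorem dispersionCharacter_le {G : Set X} (hG : IsOpen G) (hne : G.Nonempty) :
    dispersionCharacter X ≤ #G := csInf_le' ⟨G, hG, hne, rfl⟩

/-- In a hereditarily irresolvable open set, sets smaller than all non-empty open subsets are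
nowhere dense. -/
theorem HereditarilyIrresolvableOn.exists_closure_subset_disjoint [RegularSpace X] {O : Set X}
    (hO : HereditarilyIrresolvableOn O) {κ : Cardinal.{u}}
    (hcard : ∀ V : Set X, IsOpen V → V.Nonempty → κ ≤ #V) {V S : Set X} (hV : IsOpen V)
    (hne : V.Nonempty) (hVO : V ⊆ O) (hS : #S < κ) :
    ∃ W : Set X, IsOpen W ∧ W.Nonempty ∧ closure W ⊆ V ∧ Disjoint W S := by
  have hdiff : V ⊆ closure (V \ S) := by
    intro x hx
    rw [mem_closure_iff]
    intro U hU hxU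
    by_contra hemp
    refine ((mk_le_mk_of_subset ?_).trans_lt hS).not_ge (hcard (U ∩ V) (hU.inter hV) ⟨x, hxU, hx⟩)
    exact fun y hy => by_contra fun hyS => hemp ⟨y, hy.1, hy.2, hyS⟩
  obtain ⟨x, hx, hxS⟩ := not_subset.1 fun h => hO.not_subset_closure_diff hV hne hVO h hdiff
  obtain ⟨W, hW, hWne, hWV⟩ := exists_isOpen_closure_subset
    (hV.inter isClosed_closure.isOpen_compl) ⟨x, hx, hxS⟩
  refine ⟨W, hW, hWne, hWV.trans inter_subset_left, disjoint_left.2 fun y hy hyS => ?_⟩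
  exact (hWV (subset_closure hy)).2 (subset_closure hyS)

end Resolvability

/-! ### The main argument. -/

theorem mainTheorem4 (κ : Cardinal.{u}) (hκ : κ.IsSingular) (hcof : κ.ord.cof = ℵ₀)
    (X : Type u) [TopologicalSpace X] [RegularSpace X]
    (hΔ : κ ≤ dispersionCharacter X) (he : hatExtent X ≤ κ) :
    IsResolvable X 2 := by
  by_contra hres
  have hκ₀ : ℵ₀ < κ := hcof ▸ hκ.cof_ord_lt
  have hcard : ∀ V : Set X, IsOpen V → V.Nonempty → κ ≤ #V := fun V hV hne =>
    hΔ.trans (dispersionCharacter_le hV hne)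
  have : Nonempty X := by
    by_contra hX
    rw [not_nonempty_iff] at hX
    -- For empty `X` the dispersion character is `0`, below `κ`.
    refine (hκ.pos.trans_le hΔ).ne' ?_
    rw [dispersionCharacter]
    convert Cardinal.sInf_empty
    exact eq_empty_iff_forall_notMem.2 fun μ ⟨G, _, ⟨x, _⟩, _⟩ => hX.false x
  obtain ⟨O, hOopen, hOne, hO⟩ := exists_isOpen_hereditarilyIrresolvableOn hres
  obtain ⟨V₀, hV₀O, hV₀, hV₀ne, hV₀card⟩ :
      ∃ V ⊆ O, IsOpen V ∧ V.Nonempty ∧ #V ≤ κ := by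
    by_contra! h
    obtain ⟨E, -, hE, hacc⟩ := hO.exists_forall_not_accPt hκ₀.le hOopen hOne h
    exact ((mk_lt_hatExtent_of_forall_not_accPt hacc).trans_le he).ne hE
  obtain ⟨Y, hY, hYV⟩ := exists_iUnion_eq_of_cof_eq_aleph0 hκ₀.le hcof
    (hV₀card.antisymm (hcard V₀ hV₀ hV₀ne))
  let P : Set X → Prop := fun V => IsOpen V ∧ V.Nonempty ∧ V ⊆ V₀
  have hstep : ∀ (n : ℕ) (V : {V // P V}), ∃ W : {V // P V},
      closure W.1 ⊆ V.1 ∧ Disjoint W.1 (Y n) := by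
    rintro n ⟨V, hV, hne, hVV⟩
    obtain ⟨W, hW, hWne, hWV, hd⟩ :=
      hO.exists_closure_subset_disjoint hcard hV hne (hVV.trans hV₀O) (hY n)
    exact ⟨⟨W, hW, hWne, (subset_closure.trans hWV).trans hVV⟩, hWV, hd⟩
  choose F hFcl hFd using hstep
  let V : ℕ → {V // P V} := fun n => Nat.rec ⟨V₀, hV₀, hV₀ne, subset_rfl⟩ F n
  have hVcl : ∀ n, closure (V (n + 1)).1 ⊆ (V n).1 := fun n => hFcl n (V n)
  have hVd : ∀ n, Disjoint (V (n + 1)).1 (Y n) := fun n => hFd n (V n)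
  have hanti : Antitone fun n => (V n).1 :=
    antitone_nat_of_succ_le fun n => subset_closure.trans (hVcl n)
  have hemp : ⋂ n, closure (V n).1 = ∅ := by
    refine eq_empty_iff_forall_notMem.2 fun x hx => ?_
    have hxV : ∀ n, x ∈ (V n).1 := fun n => hVcl n (mem_iInter.1 hx (n + 1))
    have hxY : x ∈ ⋃ n, Y n := hYV ▸ hxV 0
    obtain ⟨n, hn⟩ := mem_iUnion.1 hxY
    exact disjoint_left.1 (hVd n) (hxV (n + 1)) hn
  -- The maximum with `ℵ₀` makes the size infinite, yet still below `κ`, as the key fact requires.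
  have hD : ∀ n, ∃ D ⊆ (V n).1, #D = max ℵ₀ #(Y n) ∧ ∀ x, ¬ AccPt x (𝓟 D) := by
    intro n
    obtain ⟨hVo, hVne, hVV⟩ := (V n).2
    refine (hO.mono (hVV.trans hV₀O)).exists_forall_not_accPt (le_max_left _ _) hVo hVne ?_
    exact fun W _ hW hWne => (max_lt hκ₀ (hY n)).trans_le (hcard W hW hWne)
  choose D hDV hDcard hDacc using hD
  have hlt := (mk_lt_hatExtent_of_forall_not_accPt
    (not_accPt_iUnion_of_eventually hDacc hDV hanti hemp)).trans_le he
  have hDle : ∀ n, max ℵ₀ #(Y n) ≤ #(⋃ n, D n) := fun n =>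
    (hDcard n).symm.trans_le (mk_le_mk_of_subset (subset_iUnion D n))
  refine ((hcard V₀ hV₀ hV₀ne).trans ?_).not_gt hlt
  rw [← hYV]
  exact mk_iUnion_nat_le ((le_max_left _ _).trans (hDle 0)) fun n => (le_max_right _ _).trans (hDle n)
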